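/- Let $(W,S)$ be a Coxeter system of arbitrary (possibly infinite) rank, with $m(s,t)\in\{1,2,\dots\}\cup\{\infty\}$ its Coxeter matrix entries. Let $V$ be its geometric representation space: the real vector space with basis $\{\alpha_s \mid s\in S\}$ and symmetric bilinear form $\langle\alpha_s,\alpha_t\rangle=-\cos(\pi/m(s,t))$ (read as $-1$ if $m(s,t)=\infty$), on which $s\in S$ acts by $s\cdot v=v-2\langle\alpha_s,v\rangle\alpha_s$. Let $\Phi=\{w\cdot\alpha_s\mid w\in W,\ s\in S\}$ be the root system, let $\Phi^+$ be the set of roots whose coefficients in the basis $\{\alpha_s\}$ are all nonnegative, and for $\gamma=w\cdot\alpha_s\in\Phi$ let $s_\gamma=wsw^{-1}$ be the corresponding reflection. A reflection subgroup of $W$ is a subgroup generated by reflections. For a reflection subgroup $G$ put $\Phi(G)=\{\gamma\in\Phi\mid s_\gamma\in G\}$, and let $\Pi(G)$ be the set of all $\gamma\in\Phi(G)\cap\Phi^+$ such that $\gamma=\sum_{i=1}^k c_i\beta_i$ with $c_i>0$ and $\beta_i\in\Phi(G)\cap\Phi^+$ implies $\beta_i=\gamma$ for every $i$. The canonical (Deodhar--Dyer)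 generating set of $G$ is $S(G)=\{s_\gamma\mid\gamma\in\Pi(G)\}$. A subgroup $G$ of $W$ is called locally parabolic if $G$ is a reflection subgroup and each finite subset of $S(G)$ is conjugate in $W$ to a subset of $S$. Theorem. The intersection of any family of locally parabolic subgroups of $W$ is again locally parabolic. Consequently, for every subset $X\subseteq W$, the intersection $LP(X)$ of all locally parabolic subgroups of $W$ containing $X$ is itself locally parabolic, and hence is the smallest locally parabolic subgroup of $W$ containing $X$ (the locally parabolic closure of $X$). -/

import Mathlib

/-- The coefficient `⟨α_i, α_j⟩ = -cos (π / m(i, j))`, read as `-1` when `m(i, j) = ∞`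
(Mathlib encodes `∞` as the entry `0` of the Coxeter matrix). -/
noncomputable def CoxeterMatrix.geomCoeff {B : Type*} (M : CoxeterMatrix B) (i j : B) : ℝ :=
  if M i j = 0 then -1 else -Real.cos (Real.pi / (M i j : ℝ))

/-- The symmetric bilinear form on the geometric representation space `V`, the real vector space
with basis the simple roots `α_i = Finsupp.single i 1`. -/
noncomputable def CoxeterMatrix.geomForm {B : Type*} (M : CoxeterMatrix B) :
    (B →₀ ℝ) →ₗ[ℝ] (B →₀ ℝ) →ₗ[ℝ] ℝ :=
  Finsupp.lift ((B →₀ ℝ) →ₗ[ℝ] ℝ) ℝ B fun i => Finsupp.lift ℝ ℝ B fun j => M.geomCoeff i j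

theorem CoxeterMatrix.geomForm_single {B : Type*} (M : CoxeterMatrix B) (i j : B) :
    M.geomForm (Finsupp.single i 1) (Finsupp.single j 1) = M.geomCoeff i j := by
  simp [CoxeterMatrix.geomForm]

theorem CoxeterMatrix.geomCoeff_self {B : Type*} (M : CoxeterMatrix B) (i : B) :
    M.geomCoeff i i = 1 := by
  simp [CoxeterMatrix.geomCoeff]

theorem CoxeterMatrix.geomForm_self {B : Type*} (M : CoxeterMatrix B) (i : B) :
    ((2 : ℝ) • M.geomForm (Finsupp.single i 1)) (Finsupp.single i 1) = 2 := by
  rw [LinearMap.smul_apply, M.geomForm_single, M.geomCoeff_self, smul_eq_mul, mul_one]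

/-- The reflection `v ↦ v - 2 ⟨α_i, v⟩ α_i` of the geometric representation space. -/
noncomputable def CoxeterMatrix.geomReflection {B : Type*} (M : CoxeterMatrix B) (i : B) :
    (B →₀ ℝ) ≃ₗ[ℝ] (B →₀ ℝ) :=
  Module.reflection (M.geomForm_self i)

/-- The reflections `v ↦ v - 2 ⟨α_i, v⟩ α_i` satisfy the Coxeter relations. -/
theorem CoxeterMatrix.isLiftable_geomReflection {B : Type*} (M : CoxeterMatrix B) :
    M.IsLiftable M.geomReflection := by
  intro i j
  by_cases h0 : M i j = 0
  · rw [h0, pow_zero]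
  by_cases h1 : M i j = 1
  · have hij : i = j := by
      by_contra h
      exact M.off_diagonal i j h h1
    subst hij
    rw [h1, pow_one]
    ext1 v
    exact Module.involutive_reflection (M.geomForm_self i) v
  have hsymm : M.geomCoeff j i = M.geomCoeff i j := by
    simp only [CoxeterMatrix.geomCoeff, M.symmetric j i]
  have hc : M.geomCoeff i j = -Real.cos (Real.pi / (M i j : ℝ)) := by
    simp [CoxeterMatrix.geomCoeff, h0]
  apply LinearEquiv.ext
  intro v
  have key := Module.reflection_mul_reflection_pow_apply (M.geomForm_self i) (M.geomForm_self j)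
    (M i j) v (2 * Real.cos (2 * (Real.pi / (M i j : ℝ)))) (by
      simp only [LinearMap.smul_apply, M.geomForm_single, hsymm, hc, smul_eq_mul]
      rw [Real.cos_two_mul]
      ring)
  refine key.trans ?_
  by_cases h2 : M i j = 2
  · have e : (2 * Real.cos (2 * (Real.pi / ((2 : ℕ) : ℝ)))) = -2 := by
      rw [show 2 * (Real.pi / ((2 : ℕ) : ℝ)) = Real.pi by push_cast; ring, Real.cos_pi]
      norm_num
    have hij : M.geomCoeff i j = 0 := by
      rw [hc, h2]
      push_cast
      rw [Real.cos_pi_div_two, neg_zero]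
    rw [h2, e]
    simp only [LinearMap.smul_apply, M.geomForm_single, hsymm, hij, smul_eq_mul]
    norm_num [Polynomial.Chebyshev.S_zero, Polynomial.Chebyshev.S_one,
      Polynomial.Chebyshev.S_neg_one]
    module
  have h3 : (3 : ℝ) ≤ (M i j : ℝ) := by
    have : 3 ≤ M i j := by omega
    exact_mod_cast this
  set m := M i j with hm
  have hpi := Real.pi_pos
  have hm0 : (m : ℝ) ≠ 0 := by positivity
  set θ : ℝ := 2 * (Real.pi / (m : ℝ)) with hθ
  have hmθ : (m : ℝ) * θ = 2 * Real.pi := by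
    rw [hθ]
    field_simp
  have hθ0 : 0 < θ := by positivity
  have hθ1 : θ < Real.pi := by nlinarith
  have hsin : Real.sin θ ≠ 0 := (Real.sin_pos_of_pos_of_lt_pi hθ0 hθ1).ne'
  have hS : ∀ k : ℤ, (Polynomial.Chebyshev.S ℝ k).eval (2 * Real.cos θ) * Real.sin θ =
      Real.sin ((k + 1) * θ) := fun k => Polynomial.Chebyshev.S_two_mul_real_cos θ k
  rcases Nat.even_or_odd' m with ⟨k, hk | hk⟩
  · have e1 : ((m : ℤ) - 2) / 2 = k - 1 := by omega
    have e2 : ((m : ℤ) - 1) / 2 = k - 1 := by omega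
    have z : (Polynomial.Chebyshev.S ℝ ((k : ℤ) - 1)).eval (2 * Real.cos θ) = 0 := by
      have h := hS ((k : ℤ) - 1)
      have hkθ : (((k : ℤ) - 1 : ℤ) + 1 : ℝ) * θ = Real.pi := by
        have : (m : ℝ) = 2 * k := by exact_mod_cast hk
        rw [this] at hmθ
        push_cast
        linarith
      rw [hkθ, Real.sin_pi] at h
      exact (mul_eq_zero.mp h).resolve_right hsin
    rw [e1, e2, z]
    simp
  · have e1 : ((m : ℤ) - 2) / 2 = k - 1 := by omega
    have e2 : ((m : ℤ) - 1) / 2 = k := by omega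
    have e3 : ((m : ℤ) - 3) / 2 = k - 1 := by omega
    have e4 : (m : ℤ) / 2 = k := by omega
    have z : (Polynomial.Chebyshev.S ℝ (k : ℤ)).eval (2 * Real.cos θ) +
        (Polynomial.Chebyshev.S ℝ ((k : ℤ) - 1)).eval (2 * Real.cos θ) = 0 := by
      have h := hS (k : ℤ)
      have h' := hS ((k : ℤ) - 1)
      have hkθ : (((k : ℤ) : ℝ) + 1) * θ = 2 * Real.pi - (k : ℝ) * θ := by
        have : (m : ℝ) = 2 * k + 1 := by exact_mod_cast hk
        rw [this] at hmθ
        push_cast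
        linarith
      have hkθ' : (((k : ℤ) - 1 : ℤ) + 1 : ℝ) * θ = (k : ℝ) * θ := by
        push_cast
        ring
      rw [hkθ, Real.sin_two_pi_sub] at h
      rw [hkθ'] at h'
      have : ((Polynomial.Chebyshev.S ℝ (k : ℤ)).eval (2 * Real.cos θ) +
        (Polynomial.Chebyshev.S ℝ ((k : ℤ) - 1)).eval (2 * Real.cos θ)) * Real.sin θ = 0 := by
        rw [add_mul, h, h']
        ring
      exact (mul_eq_zero.mp this).resolve_right hsin
    rw [e1, e2, e3, e4, z]
    simp

/-- The geometric representation of a Coxeter group: the simple reflection `s_i` acts on the real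
vector space with basis `(α_i)` by `v ↦ v - 2 ⟨α_i, v⟩ α_i`. -/
noncomputable def CoxeterSystem.geomRep {B W : Type*} [Group W] {M : CoxeterMatrix B}
    (cs : CoxeterSystem M W) : W →* ((B →₀ ℝ) ≃ₗ[ℝ] (B →₀ ℝ)) :=
  cs.lift ⟨M.geomReflection, M.isLiftable_geomReflection⟩

theorem CoxeterSystem.geomRep_simple {B W : Type*} [Group W] {M : CoxeterMatrix B}
    (cs : CoxeterSystem M W) (i : B) (v : B →₀ ℝ) :
    cs.geomRep (cs.simple i) v =
      v - (2 * M.geomForm (Finsupp.single i 1) v) • Finsupp.single i 1 := by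
  rw [CoxeterSystem.geomRep, cs.lift_apply_simple]
  rfl

/-- `cs.IsRootOf γ t`: the vector `γ` is a root, i.e. `γ = w · α_i` for some `w` and some simple
root `α_i`, and `t` is the reflection `s_γ = w s_i w⁻¹` along it. -/
def CoxeterSystem.IsRootOf {B W : Type*} [Group W] {M : CoxeterMatrix B}
    (cs : CoxeterSystem M W) (γ : B →₀ ℝ) (t : W) : Prop :=
  ∃ (w : W) (i : B), γ = cs.geomRep w (Finsupp.single i 1) ∧ t = w * cs.simple i * w⁻¹

/-- `G` is a reflection subgroup: it is generated by a set of reflections. -/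
def CoxeterSystem.IsReflectionSubgroup {B W : Type*} [Group W] {M : CoxeterMatrix B}
    (cs : CoxeterSystem M W) (G : Subgroup W) : Prop :=
  ∃ T : Set W, (∀ t ∈ T, cs.IsReflection t) ∧ G = Subgroup.closure T

/-- `Φ(G) ∩ Φ⁺`: the positive roots `γ` (all coefficients in the basis of simple roots are
nonnegative) whose reflection `s_γ` lies in `G`. -/
def CoxeterSystem.posRoots {B W : Type*} [Group W] {M : CoxeterMatrix B}
    (cs : CoxeterSystem M W) (G : Subgroup W) : Set (B →₀ ℝ) :=
  {γ | (∃ t ∈ G, cs.IsRootOf γ t) ∧ ∀ i, 0 ≤ γ i}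

/-- `Π(G)`: the simple roots of `G`, those `γ ∈ Φ(G) ∩ Φ⁺` such that `γ = c₁ β₁ + ⋯ + c_k β_k` with
`c_l > 0` and `β_l ∈ Φ(G) ∩ Φ⁺` forces every `β_l` to be `γ`. -/
def CoxeterSystem.simpleRoots {B W : Type*} [Group W] {M : CoxeterMatrix B}
    (cs : CoxeterSystem M W) (G : Subgroup W) : Set (B →₀ ℝ) :=
  {γ | γ ∈ cs.posRoots G ∧
    ∀ (k : ℕ) (c : Fin k → ℝ) (β : Fin k → B →₀ ℝ),
      (∀ l, 0 < c l) → (∀ l, β l ∈ cs.posRoots G) → γ = ∑ l, c l • β l → ∀ l, β l = γ}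

/-- `S(G) = {s_γ | γ ∈ Π(G)}`: the canonical generating set of a reflection subgroup `G`. -/
def CoxeterSystem.canonicalGenerators {B W : Type*} [Group W] {M : CoxeterMatrix B}
    (cs : CoxeterSystem M W) (G : Subgroup W) : Set W :=
  {t | ∃ γ ∈ cs.simpleRoots G, cs.IsRootOf γ t}

/-- `G` is locally parabolic: it is a reflection subgroup, and every finite subset of `S(G)` is
conjugate in `W` to a subset of the set `S = Set.range cs.simple` of simple reflections. -/
def CoxeterSystem.IsLocallyParabolic {B W : Type*} [Group W] {M : CoxeterMatrix B}
    (cs : CoxeterSystem M W) (G : Subgroup W) : Prop :=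
  cs.IsReflectionSubgroup G ∧
    ∀ X : Set W, X.Finite → X ⊆ cs.canonicalGenerators G →
      ∃ w : W, (fun x => w * x * w⁻¹) '' X ⊆ Set.range cs.simple

/-- `LP(X)`: the intersection of all locally parabolic subgroups that contain `X`. -/
def CoxeterSystem.locallyParabolicClosure {B W : Type*} [Group W] {M : CoxeterMatrix B}
    (cs : CoxeterSystem M W) (X : Set W) : Subgroup W :=
  sInf {G : Subgroup W | cs.IsLocallyParabolic G ∧ X ⊆ G}

/-! ### Dihedral root coefficients -/

namespace CoxeterMatrix

variable {B : Type*} (M : CoxeterMatrix B)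

/-! The key is a criterion free of roots, `isLocallyParabolic_iff`: `G` is locally parabolic exactly
when every finite `Y ⊆ G` lies in some parabolic `w W_I w⁻¹ ≤ G`. A finite `Y` has a least parabolic
subgroup containing it, its parabolic closure, which does not depend on `G`. If `Y` lies in every
member of a family, the closure lies below the parabolic that each member provides, hence in the
intersection.

The closure is a parabolic of least finite rank over `Y`. Kilmoyer's theorem on `W_I ∩ d W_J d⁻¹`
would lower the rank if another parabolic over `Y` did not contain it.

One direction of the criterion needs the Deodhar–Dyer theorem that `S(G)` generates `G`, so that `Y`
involves only finitely many canonical generators. For the other, take `w` shortest in `w W_I`. A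
root in `Π(G)` whose reflection lies in `w W_I w⁻¹` is a positive combination of positive roots `w
α_i` of `G`, so indecomposability makes it one of them.

All of this rests on each root being positive or negative, with sign read off from descents. -/

theorem geomCoeff_comm (i j : B) : M.geomCoeff i j = M.geomCoeff j i := by
  simp only [geomCoeff, M.symmetric j i]

theorem geomForm_comm (x y : B →₀ ℝ) : M.geomForm x y = M.geomForm y x := by
  have h : M.geomForm = M.geomForm.flip := by
    ext i j
    simp [M.geomForm_single, M.geomCoeff_comm i j]
  exact LinearMap.congr_fun₂ h x y

/-- The coefficients of the roots of the dihedral group of order `2 m` (infinite if `m = 0`) with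
respect to its simple roots. -/
noncomputable def dihedralCoeff (m k : ℕ) : ℝ :=
  if m = 0 then k else Real.sin (k * (Real.pi / m)) / Real.sin (Real.pi / m)

theorem dihedralCoeff_zero (m : ℕ) : dihedralCoeff m 0 = 0 := by
  simp [dihedralCoeff]

/-- For `m = 1` the quotient is `0 / 0 = 0`, hence the exclusion. -/
theorem dihedralCoeff_one {m : ℕ} (hm : m ≠ 1) : dihedralCoeff m 1 = 1 := by
  unfold dihedralCoeff
  split_ifs with h
  · simp
  · have h2 : (2 : ℝ) ≤ m := by
      have : 2 ≤ m := by omega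
      exact_mod_cast this
    have hlt : Real.pi / m < Real.pi := div_lt_self Real.pi_pos (by linarith)
    have := Real.sin_pos_of_pos_of_lt_pi (by positivity) hlt
    rw [Nat.cast_one, one_mul, div_self this.ne']

theorem dihedralCoeff_add_two (i j : B) (k : ℕ) :
    dihedralCoeff (M i j) (k + 2) =
      -(2 * M.geomCoeff i j * dihedralCoeff (M i j) (k + 1)) - dihedralCoeff (M i j) k := by
  unfold dihedralCoeff geomCoeff
  split_ifs with h
  · push_cast
    ring
  · set θ := Real.pi / (M i j : ℝ)
    have e1 : ((k + 2 : ℕ) : ℝ) * θ = ((k + 1 : ℕ) : ℝ) * θ + θ := by push_cast; ring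
    have e2 : (k : ℝ) * θ = ((k + 1 : ℕ) : ℝ) * θ - θ := by push_cast; ring
    rw [e1, e2, Real.sin_add, Real.sin_sub]
    ring

theorem dihedralCoeff_nonneg {m k : ℕ} (h : m ≠ 0 → k ≤ m) : 0 ≤ dihedralCoeff m k := by
  unfold dihedralCoeff
  split_ifs with h0
  · positivity
  · have hm : (1 : ℝ) ≤ m := by exact_mod_cast Nat.one_le_iff_ne_zero.2 h0
    have hk : (k : ℝ) ≤ m := by exact_mod_cast h h0
    have hpi := Real.pi_pos
    refine div_nonneg (Real.sin_nonneg_of_nonneg_of_le_pi (by positivity) ?_)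
      (Real.sin_nonneg_of_nonneg_of_le_pi (by positivity) (div_le_self hpi.le hm))
    rw [← mul_div_assoc, div_le_iff₀ (by positivity)]
    nlinarith

end CoxeterMatrix

/-! ### Signs of roots and faithfulness -/

namespace CoxeterSystem

open CoxeterMatrix

variable {B W : Type*} [Group W] {M : CoxeterMatrix B} (cs : CoxeterSystem M W)

/-- The simple root `α_i`. -/
noncomputable abbrev simpleRoot (i : B) : B →₀ ℝ := Finsupp.single i 1

theorem simpleRoot_nonneg (i : B) : 0 ≤ simpleRoot i :=
  Finsupp.single_nonneg.2 zero_le_one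

theorem geomRep_mul_apply (w w' : W) (v : B →₀ ℝ) :
    cs.geomRep (w * w') v = cs.geomRep w (cs.geomRep w' v) := by
  rw [map_mul, LinearEquiv.mul_apply]

theorem geomRep_inv_apply_self (w : W) (v : B →₀ ℝ) :
    cs.geomRep w⁻¹ (cs.geomRep w v) = v := by
  rw [← geomRep_mul_apply, inv_mul_cancel, map_one, LinearEquiv.coe_one, id]

theorem geomRep_apply_inv_self (w : W) (v : B →₀ ℝ) :
    cs.geomRep w (cs.geomRep w⁻¹ v) = v := by
  rw [← geomRep_mul_apply, mul_inv_cancel, map_one, LinearEquiv.coe_one, id]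

theorem geomRep_simple_simpleRoot (i j : B) :
    cs.geomRep (cs.simple i) (simpleRoot j) =
      simpleRoot j - (2 * M.geomCoeff i j) • simpleRoot i := by
  rw [geomRep_simple, M.geomForm_single]

theorem geomRep_simple_self (i : B) :
    cs.geomRep (cs.simple i) (simpleRoot i) = -simpleRoot i := by
  rw [geomRep_simple_simpleRoot, M.geomCoeff_self]
  module

theorem geomForm_geomRep (w : W) (x y : B →₀ ℝ) :
    M.geomForm (cs.geomRep w x) (cs.geomRep w y) = M.geomForm x y := by
  induction w using cs.simple_induction_left generalizing x y with
  | one => simp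
  | mul_simple_left w i ih =>
    rw [geomRep_mul_apply, geomRep_mul_apply, geomRep_simple, geomRep_simple]
    simp only [map_sub, map_smul, LinearMap.sub_apply, LinearMap.smul_apply, M.geomForm_single,
      M.geomCoeff_self, smul_eq_mul, ih]
    rw [M.geomForm_comm (cs.geomRep w x) (Finsupp.single i 1)]
    ring

/-- The word ends in `j` and grows on the left. Each new letter turns the coefficient pair
`(c_{k+1}, c_k)` into `(c_{k+2}, c_{k+1})`, by the recurrence `dihedralCoeff_add_two`. -/
theorem geomRep_alternatingWord {i j : B} (hij : i ≠ j) (k : ℕ) :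
    cs.geomRep (cs.wordProd (alternatingWord i j k)) (simpleRoot i) =
      dihedralCoeff (M i j) (k + 1) • simpleRoot (if Even k then i else j) +
      dihedralCoeff (M i j) k • simpleRoot (if Even k then j else i) := by
  induction k with
  | zero => simp [alternatingWord, dihedralCoeff_zero, dihedralCoeff_one (M.off_diagonal i j hij)]
  | succ k ih =>
    rw [alternatingWord_succ', wordProd_cons, geomRep_mul_apply, ih, map_add, map_smul, map_smul,
      geomRep_simple_self, geomRep_simple_simpleRoot, M.dihedralCoeff_add_two]
    by_cases hk : Even k
    · simp only [hk, if_true, Nat.even_add_one, not_true, if_false, M.geomCoeff_comm j i]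
      module
    · simp only [hk, if_false, Nat.even_add_one, not_false_iff, if_true]
      module

/-- Splitting off a maximal alternating suffix in two letters `i`, `j`, beginning with the right
descent `j`. -/
theorem exists_mul_alternatingWord {w : W} {i j : B} (hj : cs.IsRightDescent w j) :
    ∃ (v : W) (k : ℕ), w = v * cs.wordProd (alternatingWord i j k) ∧
      cs.length w = cs.length v + k ∧ 0 < k ∧
      ¬ cs.IsRightDescent v i ∧ ¬ cs.IsRightDescent v j := by
  classical
  let P : ℕ → Prop := fun k => ∃ v : W, w = v * cs.wordProd (alternatingWord i j k) ∧
      cs.length w = cs.length v + k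
  have hP1 : P 1 := by
    refine ⟨w * cs.simple j, by simp [alternatingWord], ?_⟩
    have := cs.isRightDescent_iff.1 hj
    omega
  have hle : ∀ k, P k → k ≤ cs.length w := by
    rintro k ⟨v, -, h⟩
    omega
  set k := Nat.findGreatest P (cs.length w)
  have hk1 : 1 ≤ k := Nat.le_findGreatest (hle 1 hP1) hP1
  obtain ⟨v, hv, hl⟩ : P k := Nat.findGreatest_spec (hle 1 hP1) hP1
  have hmax : ¬ P (k + 1) := fun h => by
    have := Nat.le_findGreatest (hle _ h) h
    omega
  have hnext : ¬ cs.IsRightDescent v (if Even k then j else i) := by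
    intro hd
    refine hmax ⟨v * cs.simple (if Even k then j else i), ?_, ?_⟩
    · rw [alternatingWord_succ', wordProd_cons, ← mul_assoc, simple_mul_simple_cancel_right]
      exact hv
    · have := cs.isRightDescent_iff.1 hd
      omega
  -- This letter is the first letter of the suffix. Were it a descent of `v`, cancelling it would
  -- give `w` length at most `(ℓ(v) - 1) + (k - 1)`.
  have hprev : ¬ cs.IsRightDescent v (if Even k then i else j) := by
    intro hd
    obtain ⟨l, hkl⟩ : ∃ l, k = l + 1 := ⟨k - 1, by omega⟩
    have hw : w = v * cs.simple (if Even k then i else j) *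
        cs.wordProd (alternatingWord i j l) := by
      rw [hv, hkl, alternatingWord_succ', wordProd_cons, ← mul_assoc]
      by_cases hl : Even l <;> simp [hl, Nat.even_add_one]
    have h1 := cs.length_mul_le (v * cs.simple (if Even k then i else j))
      (cs.wordProd (alternatingWord i j l))
    have h2 := cs.length_wordProd_le (alternatingWord i j l)
    rw [length_alternatingWord] at h2
    rw [← hw] at h1
    have := cs.isRightDescent_iff.1 hd
    omega
  refine ⟨v, k, hv, hl, hk1, ?_⟩
  by_cases hk : Even k
  · simp only [hk, if_true] at hnext hprev
    exact ⟨hprev, hnext⟩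
  · simp only [hk, if_false] at hnext hprev
    exact ⟨hnext, hprev⟩

/-- Split off a maximal alternating suffix in `i` and a descent `j`. The remaining `v` is shorter
and has neither descent, so `v α_i` and `v α_j` are nonnegative by induction, and `w α_i` combines
them with dihedral coefficients. -/
theorem geomRep_simpleRoot_nonneg {w : W} {i : B} (h : ¬ cs.IsRightDescent w i) :
    0 ≤ cs.geomRep w (simpleRoot i) := by
  induction hn : cs.length w using Nat.strong_induction_on generalizing w i with
  | _ n ih =>
    subst hn
    by_cases hw : w = 1
    · subst hw
      simp
    obtain ⟨j, hj⟩ := cs.exists_rightDescent_of_ne_one hw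
    have hij : i ≠ j := by
      rintro rfl
      exact h hj
    obtain ⟨v, k, hv, hl, hk, hi', hj'⟩ := cs.exists_mul_alternatingWord (i := i) hj
    have hvi := ih _ (by omega) hi' rfl
    have hvj := ih _ (by omega) hj' rfl
    -- Otherwise the alternating word of length `k + 1` is not reduced, so `w s_i` is shorter than
    -- `ℓ(v) + k + 1 = ℓ(w) + 1`, against `i` not being a descent.
    have hkm : M i j ≠ 0 → k + 1 ≤ M i j := by
      intro h0
      by_contra hlt
      have hnr := cs.not_isReduced_alternatingWord j i (m := k + 1)
        (by rwa [M.symmetric]) (by rw [M.symmetric]; omega)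
      have h1 := cs.length_wordProd_le (alternatingWord j i (k + 1))
      rw [length_alternatingWord] at h1
      have h2 : cs.length (cs.wordProd (alternatingWord j i (k + 1))) ≠ k + 1 := by
        intro h2
        exact hnr (by rw [IsReduced, h2, length_alternatingWord])
      have h3 : w * cs.simple i = v * cs.wordProd (alternatingWord j i (k + 1)) := by
        rw [alternatingWord_succ, wordProd_concat, ← mul_assoc, ← hv]
      have h4 := cs.length_mul_le v (cs.wordProd (alternatingWord j i (k + 1)))
      rw [← h3] at h4
      have h5 := cs.not_isRightDescent_iff.1 h
      omega
    rw [hv, geomRep_mul_apply, geomRep_alternatingWord _ hij, map_add, map_smul, map_smul]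
    refine add_nonneg (smul_nonneg (dihedralCoeff_nonneg hkm) ?_)
      (smul_nonneg (dihedralCoeff_nonneg fun h0 => (Nat.le_succ k).trans (hkm h0)) ?_)
    · split_ifs <;> assumption
    · split_ifs <;> assumption

theorem geomRep_simpleRoot_nonpos {w : W} {i : B} (h : cs.IsRightDescent w i) :
    cs.geomRep w (simpleRoot i) ≤ 0 := by
  have h' : ¬ cs.IsRightDescent (w * cs.simple i) i := by
    rw [IsRightDescent, simple_mul_simple_cancel_right]
    exact h.le.not_gt
  have := cs.geomRep_simpleRoot_nonneg h'
  rw [geomRep_mul_apply, geomRep_simple_self, map_neg] at this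
  exact neg_nonneg.1 this

theorem geomRep_simpleRoot_ne_zero (w : W) (i : B) : cs.geomRep w (simpleRoot i) ≠ 0 := by
  simp [simpleRoot]

theorem geomRep_injective : Function.Injective cs.geomRep := by
  rw [injective_iff_map_eq_one]
  intro w hw
  by_contra hne
  obtain ⟨i, hi⟩ := cs.exists_rightDescent_of_ne_one hne
  have h := cs.geomRep_simpleRoot_nonpos hi
  rw [hw, LinearEquiv.coe_one, id] at h
  have := h i
  norm_num [simpleRoot] at this

end CoxeterSystem

/-! ### Roots, reflections and exchange -/

namespace CoxeterSystem

variable {B W : Type*} [Group W] {M : CoxeterMatrix B} (cs : CoxeterSystem M W)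

theorem isRootOf_simpleRoot (i : B) : cs.IsRootOf (simpleRoot i) (cs.simple i) :=
  ⟨1, i, by simp, by simp⟩

variable {cs}

namespace IsRootOf

variable {γ δ : B →₀ ℝ} {t t' : W}

theorem isReflection (h : cs.IsRootOf γ t) : cs.IsReflection t := by
  obtain ⟨w, i, -, ht⟩ := h
  exact ⟨w, i, ht⟩

theorem conj (h : cs.IsRootOf γ t) (w : W) :
    cs.IsRootOf (cs.geomRep w γ) (w * t * w⁻¹) := by
  obtain ⟨u, i, rfl, rfl⟩ := h
  exact ⟨w * u, i, by rw [geomRep_mul_apply], by group⟩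

theorem neg (h : cs.IsRootOf γ t) : cs.IsRootOf (-γ) t := by
  obtain ⟨u, i, rfl, rfl⟩ := h
  refine ⟨u * cs.simple i, i, ?_, ?_⟩
  · rw [geomRep_mul_apply, geomRep_simple_self, map_neg]
  · rw [simple_mul_simple_cancel_right, mul_inv_rev, inv_simple, mul_assoc]

theorem ne_zero (h : cs.IsRootOf γ t) : γ ≠ 0 := by
  obtain ⟨u, i, rfl, -⟩ := h
  exact cs.geomRep_simpleRoot_ne_zero u i

theorem nonneg_or_nonpos (h : cs.IsRootOf γ t) : 0 ≤ γ ∨ γ ≤ 0 := by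
  obtain ⟨u, i, rfl, -⟩ := h
  by_cases hd : cs.IsRightDescent u i
  · exact Or.inr (cs.geomRep_simpleRoot_nonpos hd)
  · exact Or.inl (cs.geomRep_simpleRoot_nonneg hd)

theorem geomForm_self (h : cs.IsRootOf γ t) : M.geomForm γ γ = 1 := by
  obtain ⟨u, i, rfl, -⟩ := h
  rw [geomForm_geomRep, M.geomForm_single, M.geomCoeff_self]

theorem geomRep_apply (h : cs.IsRootOf γ t) (v : B →₀ ℝ) :
    cs.geomRep t v = v - (2 * M.geomForm γ v) • γ := by
  obtain ⟨u, i, rfl, rfl⟩ := h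
  have hf : M.geomForm (cs.geomRep u (Finsupp.single i 1)) v =
      M.geomForm (Finsupp.single i 1) (cs.geomRep u⁻¹ v) := by
    conv_lhs => rw [← cs.geomRep_apply_inv_self u v, geomForm_geomRep]
  rw [geomRep_mul_apply, geomRep_mul_apply, geomRep_simple, map_sub, map_smul,
    geomRep_apply_inv_self, hf]

theorem geomRep_self (h : cs.IsRootOf γ t) : cs.geomRep t γ = -γ := by
  rw [h.geomRep_apply, h.geomForm_self]
  module

/-- By faithfulness, since the action of `t` is a formula in `γ` alone. This makes `s_γ` well
defined. -/
theorem reflection_unique (h : cs.IsRootOf γ t) (h' : cs.IsRootOf γ t') : t = t' := by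
  apply cs.geomRep_injective
  ext1 v
  rw [h.geomRep_apply, h'.geomRep_apply]

theorem mul_eq_mul (h : cs.IsRootOf γ t) {w : W} (h' : cs.IsRootOf (cs.geomRep w γ) t') :
    w * t = t' * w := by
  rw [← (h.conj w).reflection_unique h', inv_mul_cancel_right]

/-- The bounds force `γ` to be a nonnegative multiple of `α_i`, and roots have norm one. -/
theorem eq_simpleRoot_of_le_smul (h : cs.IsRootOf γ t) (h0 : 0 ≤ γ) {i : B} {c : ℝ}
    (hle : γ ≤ c • simpleRoot i) : γ = simpleRoot i := by
  classical
  have hγ : γ = γ i • simpleRoot i := by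
    ext j
    by_cases hj : i = j
    · subst hj
      simp [simpleRoot]
    · have h1 := hle j
      have h2 := h0 j
      simp only [simpleRoot, Finsupp.smul_apply, Finsupp.single_apply, if_neg hj, smul_eq_mul,
        mul_zero, Finsupp.coe_zero, Pi.zero_apply] at h1 h2 ⊢
      exact le_antisymm h1 h2
  have h1 := h.geomForm_self
  rw [hγ] at h1
  simp only [map_smul, LinearMap.smul_apply, M.geomForm_single, M.geomCoeff_self,
    smul_eq_mul, mul_one] at h1
  have hi : 0 ≤ γ i := h0 i
  have : γ i = 1 := by nlinarith
  rw [hγ, this, one_smul]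

theorem eq_simpleRoot_of_geomRep_simple_nonpos (h : cs.IsRootOf γ t) (h0 : 0 ≤ γ) {i : B}
    (hle : cs.geomRep (cs.simple i) γ ≤ 0) : γ = simpleRoot i := by
  rw [geomRep_simple, sub_nonpos] at hle
  exact h.eq_simpleRoot_of_le_smul h0 hle

/-- The exchange condition: a word that makes a positive root `γ` negative has a suffix that sends
`γ` to the simple root of the letter preceding that suffix. -/
theorem exists_eq_append_cons (h : cs.IsRootOf γ t) (h0 : 0 ≤ γ) {ω : List B}
    (hω : cs.geomRep (cs.wordProd ω) γ ≤ 0) :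
    ∃ (u : List B) (i : B) (v : List B), ω = u ++ i :: v ∧
      cs.geomRep (cs.wordProd v) γ = simpleRoot i := by
  induction ω with
  | nil =>
    rw [wordProd_nil, map_one, LinearEquiv.coe_one, id] at hω
    exact absurd (le_antisymm hω h0) h.ne_zero
  | cons i ω ih =>
    rcases (h.conj (cs.wordProd ω)).nonneg_or_nonpos with hp | hn
    · rw [wordProd_cons, geomRep_mul_apply] at hω
      exact ⟨[], i, ω, rfl, (h.conj _).eq_simpleRoot_of_geomRep_simple_nonpos hp hω⟩
    · obtain ⟨u, j, v, rfl, hv⟩ := ih hn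
      exact ⟨i :: u, j, v, rfl, hv⟩

/-- Moving `t` left through `v` turns it into `s_i`, which cancels the letter `i`: multiplying by
the reflection deletes a letter. -/
theorem wordProd_append_cons_mul (h : cs.IsRootOf γ t) {u v : List B} {i : B}
    (hv : cs.geomRep (cs.wordProd v) γ = simpleRoot i) :
    cs.wordProd (u ++ i :: v) * t = cs.wordProd (u ++ v) := by
  have hvt : cs.wordProd v * t = cs.simple i * cs.wordProd v :=
    h.mul_eq_mul (by rw [hv]; exact cs.isRootOf_simpleRoot i)
  rw [wordProd_append, wordProd_append, wordProd_cons, mul_assoc, mul_assoc, hvt,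
    simple_mul_simple_cancel_left]

theorem exists_wordProd_nonpos (h : cs.IsRootOf γ t) :
    ∃ ω : List B, cs.geomRep (cs.wordProd ω) γ ≤ 0 := by
  obtain ⟨u, i, rfl, -⟩ := h
  obtain ⟨ω, hω⟩ := cs.wordProd_surjective (cs.simple i * u⁻¹)
  refine ⟨ω, ?_⟩
  rw [hω, geomRep_mul_apply, geomRep_inv_apply_self]
  change cs.geomRep (cs.simple i) (simpleRoot i) ≤ 0
  rw [geomRep_simple_self]
  exact neg_nonpos.2 (simpleRoot_nonneg i)

end IsRootOf

/-! ### Canonical generators generate -/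

theorem IsReflection.exists_isRootOf_nonneg {t : W} (ht : cs.IsReflection t) :
    ∃ γ, cs.IsRootOf γ t ∧ 0 ≤ γ := by
  obtain ⟨w, i, rfl⟩ := ht
  have h : cs.IsRootOf (cs.geomRep w (simpleRoot i)) (w * cs.simple i * w⁻¹) := ⟨w, i, rfl, rfl⟩
  rcases h.nonneg_or_nonpos with h0 | h0
  · exact ⟨_, h, h0⟩
  · exact ⟨_, h.neg, neg_nonneg.2 h0⟩

theorem IsRootOf.mem_posRoots {G : Subgroup W} {γ : B →₀ ℝ} {t : W} (h : cs.IsRootOf γ t)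
    (h0 : 0 ≤ γ) (ht : t ∈ G) : γ ∈ cs.posRoots G :=
  ⟨⟨t, ht, h⟩, h0⟩

theorem canonicalGenerators_subset (G : Subgroup W) : cs.canonicalGenerators G ⊆ G := by
  rintro t ⟨γ, ⟨⟨⟨t', ht', h'⟩, -⟩, -⟩, h⟩
  rwa [h.reflection_unique h']

/-- A positive root of `G` that is not a simple root of `G` is not the only positive root of `G`
made negative by its reflection. -/
theorem exists_geomRep_nonpos_of_notMem_simpleRoots {G : Subgroup W} {γ : B →₀ ℝ} {t : W}
    (h : cs.IsRootOf γ t) (h0 : 0 ≤ γ) (ht : t ∈ G) (hγ : γ ∉ cs.simpleRoots G) :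
    ∃ (β : B →₀ ℝ) (t' : W), t' ∈ G ∧ cs.IsRootOf β t' ∧ 0 ≤ β ∧ β ≠ γ ∧
      cs.geomRep t β ≤ 0 := by
  by_contra! hcon
  refine hγ ⟨h.mem_posRoots h0 ht, fun k c β hc hβ hsum l => ?_⟩
  have hpos : ∀ l, 0 ≤ β l + cs.geomRep t (β l) := by
    intro l
    obtain ⟨⟨t', ht', hβt⟩, hβ0⟩ := hβ l
    by_cases hl : β l = γ
    · rw [hl, h.geomRep_self, add_neg_cancel]
    · rcases (hβt.conj t).nonneg_or_nonpos with hp | hn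
      · exact add_nonneg hβ0 hp
      · exact absurd hn (hcon _ _ ht' hβt hβ0 hl)
  -- The sum is `γ + t γ = 0`, so each of its nonnegative terms vanishes.
  have hzero : ∑ l, c l • (β l + cs.geomRep t (β l)) = 0 := by
    simp only [smul_add, Finset.sum_add_distrib]
    rw [← hsum]
    have : cs.geomRep t γ = ∑ l, c l • cs.geomRep t (β l) := by
      conv_lhs => rw [hsum]
      simp only [map_sum, map_smul]
    rw [← this, h.geomRep_self, add_neg_cancel]
  rw [Finset.sum_eq_zero_iff_of_nonneg fun l _ => smul_nonneg (hc l).le (hpos l)] at hzero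
  have hl := (smul_eq_zero.1 (hzero l (Finset.mem_univ l))).resolve_left (hc l).ne'
  obtain ⟨⟨t', ht', hβt⟩, hβ0⟩ := hβ l
  by_contra hne
  exact hcon _ _ ht' hβt hβ0 hne (by
    rw [eq_neg_of_add_eq_zero_right hl]
    exact neg_nonpos.2 hβ0)

/-- Induction on the length of a word that makes `γ` negative. When `γ` is not simple, `t` is
conjugated by another reflection of `G` so that a shorter word suffices. -/
theorem mem_closure_canonicalGenerators {G : Subgroup W} (ω : List B) {γ : B →₀ ℝ} {t : W}
    (h : cs.IsRootOf γ t) (h0 : 0 ≤ γ) (ht : t ∈ G) (hω : cs.geomRep (cs.wordProd ω) γ ≤ 0) :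
    t ∈ Subgroup.closure (cs.canonicalGenerators G) := by
  induction hn : ω.length using Nat.strong_induction_on generalizing ω γ t with
  | _ n ih =>
    subst hn
    by_cases hγ : γ ∈ cs.simpleRoots G
    · exact Subgroup.subset_closure ⟨γ, hγ, h⟩
    obtain ⟨β, t', ht', hβ, hβ0, hβγ, htβ⟩ :=
      exists_geomRep_nonpos_of_notMem_simpleRoots h h0 ht hγ
    cases ω with
    | nil =>
      rw [wordProd_nil, map_one, LinearEquiv.coe_one, id] at hω
      exact absurd (le_antisymm hω h0) h.ne_zero
    | cons i ω =>
      rcases (h.conj (cs.wordProd ω)).nonneg_or_nonpos with hp | hn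
      swap
      · exact ih _ (by simp) ω h h0 ht hn rfl
      rw [wordProd_cons, geomRep_mul_apply] at hω
      have hωγ := (h.conj _).eq_simpleRoot_of_geomRep_simple_nonpos hp hω
      -- If `ω` makes a positive root `β` of `G` negative, then `t'` is handled by induction.
      -- Deleting a letter of `ω` gives a word sending `t' γ` to `α_i`. Hence `±t' γ`, whichever is
      -- positive, is made negative by a word no longer than `ω`, and `t' t t'⁻¹` is handled too.
      have key : ∀ (β : B →₀ ℝ) (t' : W), t' ∈ G → cs.IsRootOf β t' → 0 ≤ β →
          cs.geomRep (cs.wordProd ω) β ≤ 0 →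
          t ∈ Subgroup.closure (cs.canonicalGenerators G) := by
        intro β t' ht' hβ hβ0 hωβ
        have hmem := ih _ (by simp) ω hβ hβ0 ht' hωβ rfl
        obtain ⟨u, j, v, rfl, hv⟩ := hβ.exists_eq_append_cons hβ0 hωβ
        have huv : cs.geomRep (cs.wordProd (u ++ v)) (cs.geomRep t' γ) = simpleRoot i := by
          rw [← hβ.wordProd_append_cons_mul hv, ← geomRep_mul_apply, mul_assoc,
            hβ.isReflection.mul_self, mul_one, hωγ]
        have hδG : t' * t * t'⁻¹ ∈ G := G.mul_mem (G.mul_mem ht' ht) (G.inv_mem ht')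
        have hδ : t' * t * t'⁻¹ ∈ Subgroup.closure (cs.canonicalGenerators G) := by
          rcases (h.conj t').nonneg_or_nonpos with hp | hn
          · refine ih _ ?_ (i :: (u ++ v)) (h.conj t') hp hδG ?_ rfl
            · simp
            · rw [wordProd_cons, geomRep_mul_apply, huv, geomRep_simple_self]
              exact neg_nonpos.2 (simpleRoot_nonneg i)
          · refine ih _ ?_ (u ++ v) (h.conj t').neg (neg_nonneg.2 hn) hδG ?_ rfl
            · simp
            · rw [map_neg, huv]
              exact neg_nonpos.2 (simpleRoot_nonneg i)
        have := Subgroup.mul_mem _ (Subgroup.mul_mem _ (Subgroup.inv_mem _ hmem) hδ) hmem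
        simpa [mul_assoc] using this
      rcases (hβ.conj (cs.wordProd ω)).nonneg_or_nonpos with hβp | hβn
      swap
      · exact key β t' ht' hβ hβ0 hβn
      -- Either `β` or `-t β` becomes negative under `ω`. Otherwise `ω β` lies between `0` and a
      -- multiple of `α_i = ω γ`, forcing `β = γ`.
      have hβ' : cs.IsRootOf (-cs.geomRep t β) (t * t' * t⁻¹) := (hβ.conj t).neg
      rcases (hβ'.conj (cs.wordProd ω)).nonneg_or_nonpos with hβp' | hβn'
      swap
      · exact key _ _ (G.mul_mem (G.mul_mem ht ht') (G.inv_mem ht)) hβ' (neg_nonneg.2 htβ) hβn'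
      have hle : cs.geomRep (cs.wordProd ω) β ≤ (2 * M.geomForm γ β) • simpleRoot i := by
        rw [h.geomRep_apply, neg_sub, map_sub, map_smul, hωγ, sub_nonneg] at hβp'
        exact hβp'
      have := (hβ.conj _).eq_simpleRoot_of_le_smul hβp hle
      rw [← hωγ] at this
      exact absurd ((cs.geomRep _).injective this) hβγ

/-- A reflection subgroup is generated by its canonical generators. -/
theorem IsReflectionSubgroup.closure_canonicalGenerators {G : Subgroup W}
    (hG : cs.IsReflectionSubgroup G) : Subgroup.closure (cs.canonicalGenerators G) = G := by
  refine le_antisymm ((Subgroup.closure_le G).2 (canonicalGenerators_subset G)) ?_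
  obtain ⟨T, hT, rfl⟩ := hG
  refine (Subgroup.closure_le _).2 fun t ht => ?_
  obtain ⟨γ, hγ, h0⟩ := (hT t ht).exists_isRootOf_nonneg
  obtain ⟨ω, hω⟩ := hγ.exists_wordProd_nonpos
  exact mem_closure_canonicalGenerators ω hγ h0 (Subgroup.subset_closure ht) hω

end CoxeterSystem

theorem Subgroup.exists_finset_subset_closure {G : Type*} [Group G] {S Y : Set G} (hY : Y.Finite)
    (h : Y ⊆ Subgroup.closure S) :
    ∃ X : Finset G, (X : Set G) ⊆ S ∧ Y ⊆ Subgroup.closure (X : Set G) := by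
  classical
  have aux : ∀ y ∈ Subgroup.closure S,
      ∃ X : Finset G, (X : Set G) ⊆ S ∧ y ∈ Subgroup.closure (X : Set G) := by
    intro y hy
    induction hy using Subgroup.closure_induction with
    | mem x hx => exact ⟨{x}, by simpa using hx, Subgroup.subset_closure (by simp)⟩
    | one => exact ⟨∅, by simp, Subgroup.one_mem _⟩
    | mul x y _ _ hx hy =>
      obtain ⟨X, hX, hx⟩ := hx
      obtain ⟨X', hX', hy⟩ := hy
      refine ⟨X ∪ X', by simp [hX, hX'], Subgroup.mul_mem _ ?_ ?_⟩
      · exact Subgroup.closure_mono (by simp) hx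
      · exact Subgroup.closure_mono (by simp) hy
    | inv x _ hx =>
      obtain ⟨X, hX, hx⟩ := hx
      exact ⟨X, hX, Subgroup.inv_mem _ hx⟩
  choose! f hf hf' using aux
  refine ⟨hY.toFinset.biUnion f, by simpa using fun y hy => hf y (h hy), fun y hy => ?_⟩
  refine Subgroup.closure_mono ?_ (hf' y (h hy))
  exact_mod_cast Finset.subset_biUnion_of_mem f (hY.mem_toFinset.2 hy)

/-! ### Parabolic subgroups and Kilmoyer's theorem -/

namespace CoxeterSystem

variable {B W : Type*} [Group W] {M : CoxeterMatrix B} (cs : CoxeterSystem M W)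

/-- The standard parabolic subgroup generated by the simple reflections indexed by `I`. -/
def standardParabolic (I : Set B) : Subgroup W := Subgroup.closure (cs.simple '' I)

/-- The parabolic subgroup `w W_I w⁻¹`. -/
def parabolic (w : W) (I : Set B) : Subgroup W :=
  (cs.standardParabolic I).map (MulAut.conj w).toMonoidHom

variable {cs}

theorem simple_mem_standardParabolic {I : Set B} {i : B} (hi : i ∈ I) :
    cs.simple i ∈ cs.standardParabolic I :=
  Subgroup.subset_closure ⟨i, hi, rfl⟩

theorem standardParabolic_le {I : Set B} {G : Subgroup W} :
    cs.standardParabolic I ≤ G ↔ ∀ i ∈ I, cs.simple i ∈ G := by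
  simp [standardParabolic, Subgroup.closure_le, Set.subset_def]

theorem mem_parabolic {w x : W} {I : Set B} :
    x ∈ cs.parabolic w I ↔ w⁻¹ * x * w ∈ cs.standardParabolic I := by
  rw [parabolic, Subgroup.mem_map_equiv, MulAut.conj_symm_apply]

theorem parabolic_le {w : W} {I : Set B} {G : Subgroup W} :
    cs.parabolic w I ≤ G ↔ ∀ i ∈ I, w * cs.simple i * w⁻¹ ∈ G := by
  rw [parabolic, Subgroup.map_le_iff_le_comap, standardParabolic_le]
  simp

theorem conj_simple_mem_parabolic {w : W} {I : Set B} {i : B} (hi : i ∈ I) :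
    w * cs.simple i * w⁻¹ ∈ cs.parabolic w I :=
  parabolic_le.1 le_rfl i hi

theorem exists_word_of_mem_standardParabolic {I : Set B} {w : W}
    (hw : w ∈ cs.standardParabolic I) : ∃ ω : List B, (∀ i ∈ ω, i ∈ I) ∧ w = cs.wordProd ω := by
  induction hw using Subgroup.closure_induction with
  | mem x hx =>
    obtain ⟨i, hi, rfl⟩ := hx
    exact ⟨[i], by simpa using hi, by simp⟩
  | one => exact ⟨[], by simp, by simp⟩
  | mul x y _ _ hx hy =>
    obtain ⟨ω, hω, rfl⟩ := hx
    obtain ⟨ω', hω', rfl⟩ := hy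
    refine ⟨ω ++ ω', fun i hi => ?_, (cs.wordProd_append _ _).symm⟩
    exact (List.mem_append.1 hi).elim (hω i) (hω' i)
  | inv x _ hx =>
    obtain ⟨ω, hω, rfl⟩ := hx
    exact ⟨ω.reverse, by simpa using hω, by simp⟩

theorem wordProd_mem_standardParabolic {I : Set B} {ω : List B} (hω : ∀ i ∈ ω, i ∈ I) :
    cs.wordProd ω ∈ cs.standardParabolic I := by
  refine Subgroup.list_prod_mem _ fun x hx => ?_
  obtain ⟨i, hi, rfl⟩ := List.mem_map.1 hx
  exact simple_mem_standardParabolic (hω i hi)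

/-- A simple reflection changes only its own coordinate. This is used to confine the supports of
roots to `I`. -/
theorem geomRep_apply_of_mem_standardParabolic {I : Set B} {w : W}
    (hw : w ∈ cs.standardParabolic I) (v : B →₀ ℝ) {b : B} (hb : b ∉ I) :
    cs.geomRep w v b = v b := by
  classical
  obtain ⟨ω, hω, rfl⟩ := exists_word_of_mem_standardParabolic hw
  induction ω with
  | nil => simp
  | cons i ω ih =>
    have hω' : ∀ j ∈ ω, j ∈ I := fun j hj => hω j (List.mem_cons_of_mem i hj)
    have hib : i ≠ b := by
      rintro rfl
      exact hb (hω i List.mem_cons_self)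
    rw [wordProd_cons, geomRep_mul_apply, geomRep_simple]
    simp [ih hω' (wordProd_mem_standardParabolic hω'), hib]

theorem geomRep_apply_eq_sum (w : W) (v : B →₀ ℝ) :
    cs.geomRep w v = ∑ i ∈ v.support, v i • cs.geomRep w (simpleRoot i) := by
  conv_lhs => rw [← v.sum_single, Finsupp.sum, map_sum]
  refine Finset.sum_congr rfl fun i _ => ?_
  rw [← map_smul, Finsupp.smul_single_one]

theorem geomRep_nonneg {w : W} {v : B →₀ ℝ} (hv : 0 ≤ v)
    (h : ∀ i ∈ v.support, 0 ≤ cs.geomRep w (simpleRoot i)) : 0 ≤ cs.geomRep w v := by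
  rw [geomRep_apply_eq_sum]
  exact Finset.sum_nonneg fun i hi => smul_nonneg (hv i) (h i hi)

theorem geomRep_nonpos {w : W} {v : B →₀ ℝ} (hv : v ≤ 0)
    (h : ∀ i ∈ v.support, 0 ≤ cs.geomRep w (simpleRoot i)) : cs.geomRep w v ≤ 0 := by
  rw [← neg_nonneg, ← map_neg]
  exact geomRep_nonneg (neg_nonneg.2 hv) (by simpa using h)

/-- Every double coset of two standard parabolic subgroups contains an element `d` such that `d⁻¹`
and `d` keep the respective simple roots positive. -/
theorem exists_eq_mul_mul (I J : Set B) (g : W) :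
    ∃ a ∈ cs.standardParabolic I, ∃ b ∈ cs.standardParabolic J, ∃ d : W, g = a * d * b ∧
      (∀ i ∈ I, 0 ≤ cs.geomRep d⁻¹ (simpleRoot i)) ∧
      (∀ j ∈ J, 0 ≤ cs.geomRep d (simpleRoot j)) := by
  let D : Set W := {d | ∃ a ∈ cs.standardParabolic I, ∃ b ∈ cs.standardParabolic J, g = a * d * b}
  have hD : D.Nonempty := ⟨g, 1, Subgroup.one_mem _, 1, Subgroup.one_mem _, by simp⟩
  -- A shortest element of the double coset: a left descent in `I` or a right descent in `J` would
  -- give a shorter one.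
  obtain ⟨d, ⟨a, ha, b, hb, hg⟩, hmin⟩ := WellFounded.has_min (measure cs.length).wf D hD
  refine ⟨a, ha, b, hb, d, hg, fun i hi => ?_, fun j hj => ?_⟩
  · refine cs.geomRep_simpleRoot_nonneg fun hd => ?_
    rw [isRightDescent_inv_iff] at hd
    refine hmin (cs.simple i * d)
      ⟨a * cs.simple i, Subgroup.mul_mem _ ha (simple_mem_standardParabolic hi), b, hb, ?_⟩ hd
    rw [hg, ← mul_assoc, simple_mul_simple_cancel_right]
  · refine cs.geomRep_simpleRoot_nonneg fun hd => ?_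
    refine hmin (d * cs.simple j)
      ⟨a, ha, cs.simple j * b, Subgroup.mul_mem _ (simple_mem_standardParabolic hj) hb, ?_⟩ hd
    rw [hg, ← mul_assoc a, ← mul_assoc, simple_mul_simple_cancel_right]

/-- Kilmoyer's theorem, the nontrivial inclusion: `W_I ∩ d W_J d⁻¹` is generated by the simple
reflections in `I ∩ d J d⁻¹` if `d` is a minimal double coset representative. -/
theorem conj_wordProd_mem_standardParabolic {I J : Set B} {d : W}
    (hI : ∀ i ∈ I, 0 ≤ cs.geomRep d⁻¹ (simpleRoot i))
    (hJ : ∀ j ∈ J, 0 ≤ cs.geomRep d (simpleRoot j)) (ω : List B) (hω : ∀ j ∈ ω, j ∈ J)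
    (h : d * cs.wordProd ω * d⁻¹ ∈ cs.standardParabolic I) :
    d * cs.wordProd ω * d⁻¹ ∈
      cs.standardParabolic {i ∈ I | ∃ j ∈ J, cs.simple i = d * cs.simple j * d⁻¹} := by
  induction hn : ω.length using Nat.strong_induction_on generalizing ω with
  | _ n ih =>
    subst hn
    rcases List.eq_nil_or_concat ω with rfl | ⟨ω, s, rfl⟩
    · simp
    have hs : s ∈ J := hω s (by simp)
    have hω' : ∀ j ∈ ω, j ∈ J := fun j hj => hω j (by simp [hj])
    have hy : cs.wordProd (ω.concat s) = cs.wordProd ω * cs.simple s := wordProd_concat _ _ _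
    have hroot := cs.isRootOf_simpleRoot s
    rcases (hroot.conj (cs.wordProd (ω.concat s))).nonneg_or_nonpos with hp | hn
    · rw [hy, geomRep_mul_apply, geomRep_simple_self, map_neg, neg_nonneg] at hp
      obtain ⟨u, j, v, rfl, hv⟩ := hroot.exists_eq_append_cons (simpleRoot_nonneg s) hp
      rw [hroot.wordProd_append_cons_mul hv] at hy
      rw [hy] at h ⊢
      refine ih _ (by simp) (u ++ v) (fun j hj => hω' j ?_) h rfl
      simp only [List.mem_append, List.mem_cons] at hj ⊢
      tauto
    · have hds := hJ s hs
      have hxd : cs.geomRep (d * cs.wordProd (ω.concat s) * d⁻¹) (cs.geomRep d (simpleRoot s)) =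
          cs.geomRep d (cs.geomRep (cs.wordProd (ω.concat s)) (simpleRoot s)) := by
        rw [geomRep_mul_apply, geomRep_inv_apply_self, geomRep_mul_apply]
      have hneg : cs.geomRep (d * cs.wordProd (ω.concat s) * d⁻¹)
          (cs.geomRep d (simpleRoot s)) ≤ 0 := by
        rw [hxd]
        refine geomRep_nonpos hn fun j hj => hJ j ?_
        by_contra hjJ
        rw [Finsupp.mem_support_iff,
          geomRep_apply_of_mem_standardParabolic (wordProd_mem_standardParabolic hω) _ hjJ] at hj
        refine hj (Finsupp.single_eq_of_ne ?_)
        rintro rfl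
        exact hjJ hs
      -- The conjugate lies in `W_I`, so it fixes coordinates outside `I`; yet it makes the
      -- nonnegative vector `d α_s` nonpositive.
      have hsupp : ∀ i ∈ (cs.geomRep d (simpleRoot s)).support, i ∈ I := by
        intro i hi
        by_contra hiI
        have h1 := hneg i
        rw [geomRep_apply_of_mem_standardParabolic h _ hiI] at h1
        exact Finsupp.mem_support_iff.1 hi (le_antisymm h1 (hds i))
      obtain ⟨i, hi⟩ := Finsupp.support_nonempty_iff.2 (cs.geomRep_simpleRoot_ne_zero d s)
      have hc : 0 < cs.geomRep d (simpleRoot s) i :=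
        lt_of_le_of_ne (hds i) (Ne.symm (Finsupp.mem_support_iff.1 hi))
      -- Applying `d⁻¹` writes `α_s` as a sum of nonnegative terms, so each is at most `α_s`. Hence
      -- `d⁻¹ α_i = α_s`, and the last letter `s` becomes the factor `s_i = d s d⁻¹`.
      have hle : cs.geomRep d (simpleRoot s) i • cs.geomRep d⁻¹ (simpleRoot i) ≤ simpleRoot s := by
        have hsum := geomRep_apply_eq_sum (cs := cs) d⁻¹ (cs.geomRep d (simpleRoot s))
        rw [geomRep_inv_apply_self] at hsum
        conv_rhs => rw [hsum]
        exact Finset.single_le_sum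
          (f := fun i => cs.geomRep d (simpleRoot s) i • cs.geomRep d⁻¹ (simpleRoot i))
          (fun j hj => smul_nonneg (hds j) (hI j (hsupp j hj))) hi
      have hi' := ((cs.isRootOf_simpleRoot i).conj d⁻¹).eq_simpleRoot_of_le_smul
        (hI i (hsupp i hi)) (i := s) (c := (cs.geomRep d (simpleRoot s) i)⁻¹) (by
          have := smul_le_smul_of_nonneg_left hle (inv_nonneg.2 hc.le)
          rwa [smul_smul, inv_mul_cancel₀ hc.ne', one_smul] at this)
      have hsi : d⁻¹ * cs.simple i = cs.simple s * d⁻¹ :=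
        (cs.isRootOf_simpleRoot i).mul_eq_mul (by rw [hi']; exact hroot)
      have hsi' : cs.simple i = d * cs.simple s * d⁻¹ := by
        rw [mul_assoc, ← hsi, mul_inv_cancel_left]
      have hx : d * cs.wordProd (ω.concat s) * d⁻¹ =
          d * cs.wordProd ω * d⁻¹ * cs.simple i := by
        rw [hy, hsi']
        group
      rw [hx] at h ⊢
      have hxI : d * cs.wordProd ω * d⁻¹ ∈ cs.standardParabolic I := by
        simpa using Subgroup.mul_mem _ h (simple_mem_standardParabolic (hsupp i hi))
      exact Subgroup.mul_mem _ (ih _ (by simp) ω hω' hxI rfl)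
        (simple_mem_standardParabolic ⟨hsupp i hi, s, hs, hsi'⟩)

/-- A parabolic subgroup of minimal finite rank containing `Y` is contained in every parabolic
subgroup containing `Y`. -/
theorem parabolic_le_of_card_minimal {Y : Set W} {u : W} {I : Finset B}
    (hY : Y ⊆ cs.parabolic u (I : Set B))
    (hmin : ∀ (w : W) (K : Finset B), Y ⊆ cs.parabolic w (K : Set B) → I.card ≤ K.card)
    {v : W} {J : Set B} (hY' : Y ⊆ cs.parabolic v J) :
    cs.parabolic u (I : Set B) ≤ cs.parabolic v J := by
  classical
  obtain ⟨a, ha, b, hb, d, hg, hI, hJ⟩ := exists_eq_mul_mul (cs := cs) (I : Set B) J (u⁻¹ * v)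
  have hv : v = u * a * d * b := by
    rw [← mul_inv_cancel_left u v, hg]
    group
  let K : Finset B := I.filter fun i => ∃ j ∈ J, cs.simple i = d * cs.simple j * d⁻¹
  have hK : Y ⊆ cs.parabolic (u * a) (K : Set B) := by
    intro y hy
    have h1 := mem_parabolic.1 (hY hy)
    have h2 := mem_parabolic.1 (hY' hy)
    have h3 := Subgroup.mul_mem _ (Subgroup.mul_mem _ hb h2) (Subgroup.inv_mem _ hb)
    obtain ⟨ω, hω, hωe⟩ := exists_word_of_mem_standardParabolic h3
    have e : (u * a)⁻¹ * y * (u * a) = d * cs.wordProd ω * d⁻¹ := by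
      rw [← hωe, hv]
      group
    have h4 : d * cs.wordProd ω * d⁻¹ ∈ cs.standardParabolic (I : Set B) := by
      have := Subgroup.mul_mem _ (Subgroup.mul_mem _ (Subgroup.inv_mem _ ha) h1) ha
      rw [← e]
      simpa [mul_assoc] using this
    have h5 := conj_wordProd_mem_standardParabolic hI hJ ω hω h4
    have hset : (K : Set B) =
        {i ∈ (I : Set B) | ∃ j ∈ J, cs.simple i = d * cs.simple j * d⁻¹} := by
      simp [K]
    show y ∈ cs.parabolic (u * a) (K : Set B)
    rwa [mem_parabolic, e, hset]
  -- Minimal rank forces every `s_i` with `i ∈ I` to be the `d`-conjugate of a simple reflection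
  -- from `J`.
  have hKI : K = I := Finset.eq_of_subset_of_card_le (Finset.filter_subset _ _) (hmin _ _ hK)
  rw [parabolic_le]
  intro i hi
  have hle : cs.parabolic (u * a) (I : Set B) ≤ cs.parabolic v J := by
    rw [parabolic_le]
    intro i hi
    have hi' : i ∈ I := hi
    rw [← hKI] at hi'
    obtain ⟨j, hj, hij⟩ := (Finset.mem_filter.1 hi').2
    have e : v⁻¹ * (u * a * cs.simple i * (u * a)⁻¹) * v = b⁻¹ * cs.simple j * b := by
      rw [hv, hij]
      group
    rw [mem_parabolic, e]
    exact Subgroup.mul_mem _ (Subgroup.mul_mem _ (Subgroup.inv_mem _ hb)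
      (simple_mem_standardParabolic hj)) hb
  apply hle
  have e : (u * a)⁻¹ * (u * cs.simple i * u⁻¹) * (u * a) = a⁻¹ * cs.simple i * a := by group
  rw [mem_parabolic, e]
  exact Subgroup.mul_mem _ (Subgroup.mul_mem _ (Subgroup.inv_mem _ ha)
    (simple_mem_standardParabolic hi)) ha

/-! ### Parabolic closure of a finite set -/

variable (cs) in
theorem exists_parabolic_of_finite {Y : Set W} (hY : Y.Finite) :
    ∃ (w : W) (I : Finset B), Y ⊆ cs.parabolic w (I : Set B) := by
  classical
  obtain ⟨X, hX, hYX⟩ := Subgroup.exists_finset_subset_closure (S := Set.range cs.simple) hY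
    (by simp [subgroup_closure_range_simple])
  rw [← Set.image_univ, Finset.subset_set_image_iff] at hX
  obtain ⟨I, -, rfl⟩ := hX
  refine ⟨1, I, fun y hy => ?_⟩
  have := hYX hy
  rw [Finset.coe_image] at this
  show y ∈ cs.parabolic 1 (I : Set B)
  rw [mem_parabolic]
  simpa [standardParabolic] using this

variable (cs) in
/-- The parabolic closure of a finite set. -/
theorem exists_least_parabolic_of_finite {Y : Set W} (hY : Y.Finite) :
    ∃ (u : W) (I : Set B), Y ⊆ cs.parabolic u I ∧
      ∀ (v : W) (J : Set B), Y ⊆ cs.parabolic v J → cs.parabolic u I ≤ cs.parabolic v J := by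
  let D : Set (W × Finset B) := {p | Y ⊆ cs.parabolic p.1 (p.2 : Set B)}
  obtain ⟨w, I, h⟩ := cs.exists_parabolic_of_finite hY
  obtain ⟨⟨u, I⟩, hu, hmin⟩ :=
    WellFounded.has_min (measure fun p : W × Finset B => p.2.card).wf D ⟨(w, I), h⟩
  exact ⟨u, I, hu, fun v J => parabolic_le_of_card_minimal hu
    fun w K hK => not_lt.1 (hmin (w, K) hK)⟩

/-! ### Local parabolicity by finite subsets -/

/-- If `w` keeps the simple roots in `I` positive, then the simple roots of a reflection subgroup
`G` containing `w W_I w⁻¹` whose reflections lie in `w W_I w⁻¹` are images of simple roots. -/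
theorem exists_eq_conj_simple {G : Subgroup W} {w : W} {I : Set B}
    (hw : ∀ i ∈ I, 0 ≤ cs.geomRep w (simpleRoot i)) (hG : cs.parabolic w I ≤ G) {x : W}
    (hx : x ∈ cs.canonicalGenerators G) (hxI : x ∈ cs.parabolic w I) :
    ∃ i ∈ I, x = w * cs.simple i * w⁻¹ := by
  obtain ⟨γ, ⟨⟨-, h0⟩, hγ⟩, hγx⟩ := hx
  replace h0 : 0 ≤ γ := h0
  have hδ := hγx.conj w⁻¹
  rw [inv_inv] at hδ
  set δ := cs.geomRep w⁻¹ γ with hδdef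
  have hwδ : cs.geomRep w δ = γ := cs.geomRep_apply_inv_self w γ
  -- The reflection along `δ` lies in `W_I`, so it fixes coordinates outside `I` while negating `δ`.
  have hsupp : ∀ i ∈ δ.support, i ∈ I := by
    intro i hi
    by_contra hiI
    have := geomRep_apply_of_mem_standardParabolic (mem_parabolic.1 hxI) δ hiI
    rw [hδ.geomRep_self, Finsupp.neg_apply] at this
    exact Finsupp.mem_support_iff.1 hi (by linarith)
  have hδ0 : 0 ≤ δ := by
    refine hδ.nonneg_or_nonpos.resolve_right fun hn => hγx.ne_zero (le_antisymm ?_ h0)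
    rw [← hwδ]
    exact geomRep_nonpos hn fun i hi => hw i (hsupp i hi)
  obtain ⟨i, hi⟩ := Finsupp.support_nonempty_iff.2 hδ.ne_zero
  have hroot : ∀ i, cs.IsRootOf (cs.geomRep w (simpleRoot i)) (w * cs.simple i * w⁻¹) :=
    fun i => ⟨w, i, rfl, rfl⟩
  have hsum : γ = ∑ i ∈ δ.support, δ i • cs.geomRep w (simpleRoot i) := by
    rw [← geomRep_apply_eq_sum, hwδ]
  let e := δ.support.equivFin
  -- Indecomposability of `γ = ∑ δ_i w α_i` makes every `w α_i` in the sum equal to `γ`.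
  have key := hγ δ.support.card (fun l => δ (e.symm l))
    (fun l => cs.geomRep w (simpleRoot (e.symm l : B)))
    (fun l => lt_of_le_of_ne (hδ0 _) (Ne.symm (Finsupp.mem_support_iff.1 (e.symm l).2)))
    (fun l => (hroot _).mem_posRoots (hw _ (hsupp _ (e.symm l).2))
      (hG (conj_simple_mem_parabolic (hsupp _ (e.symm l).2))))
    (by
      rw [e.symm.sum_comp fun i : δ.support => δ i • cs.geomRep w (simpleRoot (i : B)), hsum,
        ← Finset.sum_coe_sort])
    (e ⟨i, hi⟩)
  simp only [Equiv.symm_apply_apply] at key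
  refine ⟨i, hsupp i hi, hγx.reflection_unique ?_⟩
  rw [← key]
  exact hroot i

/-- A subgroup is locally parabolic if and only if each of its finite subsets lies in a parabolic
subgroup contained in it. -/
theorem isLocallyParabolic_iff {G : Subgroup W} :
    cs.IsLocallyParabolic G ↔ ∀ Y : Set W, Y.Finite → Y ⊆ G →
      ∃ (w : W) (I : Set B), Y ⊆ cs.parabolic w I ∧ cs.parabolic w I ≤ G := by
  constructor
  · rintro ⟨hG, hLP⟩ Y hY hYG
    rw [← hG.closure_canonicalGenerators] at hYG
    obtain ⟨X, hX, hYX⟩ := Subgroup.exists_finset_subset_closure hY hYG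
    obtain ⟨w, hw⟩ := hLP X X.finite_toSet hX
    refine ⟨w⁻¹, {i | w⁻¹ * cs.simple i * w ∈ X}, hYX.trans ?_, ?_⟩
    · refine (Subgroup.closure_le _).2 fun x hx => ?_
      obtain ⟨i, hi⟩ := hw ⟨x, hx, rfl⟩
      have hi' : x = w⁻¹ * cs.simple i * w := by
        rw [hi]
        group
      have := conj_simple_mem_parabolic (cs := cs) (w := w⁻¹)
        (I := {i | w⁻¹ * cs.simple i * w ∈ X}) (i := i) (by
          show w⁻¹ * cs.simple i * w ∈ X
          rwa [← hi'])
      rwa [inv_inv, ← hi'] at this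
    · refine parabolic_le.2 fun i hi => ?_
      rw [inv_inv]
      exact canonicalGenerators_subset G (hX hi)
  · intro h
    refine ⟨⟨{t | t ∈ G ∧ cs.IsReflection t}, fun t ht => ht.2, ?_⟩, fun X hX hXG => ?_⟩
    · refine le_antisymm (fun g hg => ?_) ((Subgroup.closure_le G).2 fun t ht => ht.1)
      obtain ⟨w, I, hgI, hI⟩ := h {g} (Set.finite_singleton g) (by simpa using hg)
      have hle : cs.parabolic w I ≤ Subgroup.closure {t | t ∈ G ∧ cs.IsReflection t} :=
        parabolic_le.2 fun i hi =>
          Subgroup.subset_closure ⟨hI (conj_simple_mem_parabolic hi), w, i, rfl⟩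
      exact hle (hgI (Set.mem_singleton g))
    · obtain ⟨w, I, hXI, hI⟩ := h X hX (hXG.trans (canonicalGenerators_subset G))
      -- With `∅` on the left the double coset is `w W_I`, so `d` gives the same parabolic and keeps
      -- the simple roots in `I` positive.
      obtain ⟨a, ha, b, hb, d, rfl, -, hd⟩ := exists_eq_mul_mul (cs := cs) ∅ I w
      obtain rfl : a = 1 := by simpa [standardParabolic] using ha
      rw [one_mul] at hXI hI
      have hle : cs.parabolic d I ≤ cs.parabolic (d * b) I := by
        refine parabolic_le.2 fun i hi => mem_parabolic.2 ?_
        have e : (d * b)⁻¹ * (d * cs.simple i * d⁻¹) * (d * b) = b⁻¹ * cs.simple i * b := by group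
        rw [e]
        exact Subgroup.mul_mem _ (Subgroup.mul_mem _ (Subgroup.inv_mem _ hb)
          (simple_mem_standardParabolic hi)) hb
      refine ⟨d⁻¹, ?_⟩
      rintro _ ⟨x, hx, rfl⟩
      have hxd : x ∈ cs.parabolic d I := by
        rw [mem_parabolic]
        have := Subgroup.mul_mem _ (Subgroup.mul_mem _ hb (mem_parabolic.1 (hXI hx)))
          (Subgroup.inv_mem _ hb)
        simpa [mul_assoc] using this
      obtain ⟨i, -, rfl⟩ := exists_eq_conj_simple hd (hle.trans hI) (hXG hx) hxd
      exact ⟨i, by group⟩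

theorem isLocallyParabolic_sInf {F : Set (Subgroup W)} (hF : ∀ G ∈ F, cs.IsLocallyParabolic G) :
    cs.IsLocallyParabolic (sInf F) := by
  refine isLocallyParabolic_iff.2 fun Y hY hYF => ?_
  obtain ⟨u, I, hI, hmin⟩ := cs.exists_least_parabolic_of_finite hY
  refine ⟨u, I, hI, le_sInf fun G hG => ?_⟩
  obtain ⟨v, J, hJ, hJG⟩ := isLocallyParabolic_iff.1 (hF G hG) Y hY
    fun y hy => Subgroup.mem_sInf.1 (hYF hy) G hG
  exact (hmin v J hJ).trans hJG

end CoxeterSystem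

theorem theorem4p2 {B W : Type*} [Group W] {M : CoxeterMatrix B} (cs : CoxeterSystem M W) :
    (∀ F : Set (Subgroup W), (∀ G ∈ F, cs.IsLocallyParabolic G) →
      cs.IsLocallyParabolic (sInf F)) ∧
    (∀ X : Set W, IsLeast {G : Subgroup W | cs.IsLocallyParabolic G ∧ X ⊆ G}
      (cs.locallyParabolicClosure X)) := by
  refine ⟨fun F hF => CoxeterSystem.isLocallyParabolic_sInf hF, fun X => ⟨⟨?_, ?_⟩, ?_⟩⟩
  · exact CoxeterSystem.isLocallyParabolic_sInf fun G hG => hG.1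
  · exact fun x hx => Subgroup.mem_sInf.2 fun G hG => hG.2 hx
  · exact fun G hG => sInf_le hG
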